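/- For each $N\ge 1$ consider $N$ parallel server pools, each able to hold at most $B$ simultaneous tasks, where $B\ge 1$ is a fixed finite integer. Tasks arrive as a Poisson process of rate $\lambda(N)>0$, and the active tasks have independent exponential execution times with unit mean, all served simultaneously. Under the JSQ$(d(N))$ scheme, with an integer $1\le d(N)\le N$, each arriving task is assigned to a server pool with the minimum number of active tasks among $d(N)$ uniformly randomly selected server pools (selected either with or without replacement). Ties are broken arbitrarily, possibly at random, depending on the current state and the sample. A task assigned to a pool that already holds $B$ active tasks is permanently discarded; otherwise it starts execution there immediately. For every $N\ge1$ the vector of the numbers of active tasks at the $N$ pools is a continuous-time Markov chain on $\{0,\dots,B\}^N$. Let $L^{d(N)}$ denote the steady-state loss probability, i.e. the probability that a task arriving when this chain is distributed according to its steady-state law $\pi^N(\cdot)=\lim_{t\to\infty}\mathbb P(X^N(t)=\cdot)$ (the same limit for every initial state) is discarded. Suppose that $\lambda(N)/N\to\lambda$ as $N\to\infty$, where $\lambda\le B$. Then $L^{d(N)}$ exists and is uniquely determined for every $N\ge 1$, and if $d(N)\to\infty$ as $N\to\infty$, then $$L^{d(N)}\to 0\qquad\text{as } N\to\infty .$$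 -/

import Mathlib

open Filter Topology

noncomputable section

namespace JSQ

/-- A state of `N` labelled server pools with buffer `B`: the number of active tasks
(between `0` and `B`) at each pool. -/
abbrev State (N B : ℕ) : Type := Fin N → Fin (B + 1)

/-- The two readings of "select `d` server pools at random". -/
inductive SamplingMode : Type where
  | withReplacement
  | withoutReplacement

/-- Probability that the ordered sample of `d` pools drawn from `N` pools equals `s`:
uniform over all `N ^ d` samples, or uniform over the samples of `d` distinct pools. -/
def sampleProb (mode : SamplingMode) (N d : ℕ) (s : Fin d → Fin N) : ℝ :=
  open Classical in
  match mode with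
  | .withReplacement => 1 / (N : ℝ) ^ d
  | .withoutReplacement =>
      if Function.Injective s then 1 / (N.descFactorial d : ℝ) else 0

/-- `tie x s i` is the probability that a task is assigned to pool `i`, when the state seen on
arrival is `x` and the sample is `s`. The assigned pool is a sampled pool with the minimum number
of active tasks among the sampled pools; ties are broken in an arbitrary, possibly randomized,
way. -/
structure IsTieBreakRule {N B d : ℕ} (tie : State N B → (Fin d → Fin N) → Fin N → ℝ) : Prop where
  nonneg : ∀ x s i, 0 ≤ tie x s i
  sum_eq_one : ∀ x s, ∑ i, tie x s i = 1
  sampled : ∀ x s i, tie x s i ≠ 0 → i ∈ Set.range s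
  minimal : ∀ x s i, tie x s i ≠ 0 → ∀ k, x i ≤ x (s k)

section Chain

variable {N B d : ℕ} (mode : SamplingMode) (tie : State N B → (Fin d → Fin N) → Fin N → ℝ)

/-- Probability that a task arriving in state `x` is assigned to pool `i` (where it is discarded
if that pool is full). -/
def assignProb (x : State N B) (i : Fin N) : ℝ :=
  ∑ s : Fin d → Fin N, sampleProb mode N d s * tie x s i

/-- The state `y` is the state `x` with one more task at pool `i`. -/
def IsOneMore (i : Fin N) (x y : State N B) : Prop :=
  ∀ j, (y j : ℕ) = (x j : ℕ) + if j = i then 1 else 0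

/-- Rate of the transition from `x` to `y` for Poisson arrivals of rate `a`: arrivals at a full
pool do not change the state, and each active task leaves at rate one. -/
def jumpRate (a : ℝ) (x y : State N B) : ℝ :=
  open Classical in
  (∑ i, if IsOneMore i x y then a * assignProb mode tie x i else 0)
    + ∑ i, if IsOneMore i y x then ((x i : ℕ) : ℝ) else 0

/-- The generator (rate matrix) of the JSQ(`d`) Markov chain. -/
def generator (a : ℝ) : Matrix (State N B) (State N B) ℝ :=
  Matrix.of fun x y =>
    if y = x then -∑ z ∈ Finset.univ.erase x, jumpRate mode tie a x z
    else jumpRate mode tie a x y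

/-- `transition mode tie a t x y` is the probability that the JSQ(`d`) process started from `x`
is in state `y` at time `t`. -/
def transition (a t : ℝ) : Matrix (State N B) (State N B) ℝ :=
  NormedSpace.exp (t • generator mode tie a)

/-- `π` is the steady-state distribution of the JSQ(`d`) process: the limit of its law as
`t → ∞`, from every initial state. -/
def IsSteadyState (a : ℝ) (π : State N B → ℝ) : Prop :=
  ∀ x y, Tendsto (fun t : ℝ => transition mode tie a t x y) atTop (𝓝 (π y))

/-- Probability that a task arriving in state `x` is discarded: it is assigned to a full pool. -/
def discardProb (x : State N B) : ℝ :=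
  ∑ i with (x i : ℕ) = B, assignProb mode tie x i

/-- `L` is the steady-state loss probability: the probability that a task which arrives when the
process is in steady state is discarded. -/
def IsSteadyStateLossProb (a L : ℝ) : Prop :=
  ∃ π : State N B → ℝ, IsSteadyState mode tie a π ∧ L = ∑ x, π x * discardProb mode tie x

end Chain

end JSQ

end

/-!
The steady state exists because the chain is finite and can empty itself from any state by
departures alone. So `exp Q` has a column bounded below by some `ε > 0`, and Doeblin's contraction
(`JSQ.osc_mulVec_le`) makes the oscillation of every column of `exp (t Q)` decay geometrically
(`JSQ.IsRateMatrix.exists_tendsto_exp_smul`). The limit law `π` satisfies `π (Q f) = 0` for every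
function `f` (`JSQ.limit_sum_drift_eq_zero`).

For the loss probability `L` it is enough to use `f = S` and `f = S ^ 2`, where `S` is the total
number of tasks. Write `a` for the arrival rate, `α = a / N`, `m = S / N`, and `D` for the discard
probability as a function of the state. The first choice gives the flow balance `E m = α (1 - L)`,
and the second one, combined with the first, gives

  `E (m - α) ^ 2 = α E [D (α - m)] + E m / N`.

A task is discarded only if its whole sample is full, and the fraction of full pools is at most
`m / B`, so `D ≤ (m / B) ^ d` for both sampling modes. Since `d u ^ d (1 - u) ≤ 1` on `[0, 1]`, this
yields `D (B - m) ≤ B / d` in every state. As `α L = α - E m`, Jensen's inequality now gives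

  `(α L) ^ 2 ≤ α (B / d + max (α - B) 0) + B / N`

(`JSQ.sq_load_mul_lossProb_le`). The right-hand side tends to zero when `α → λ ≤ B` and `d → ∞`, so
`L → 0` if `λ > 0`. If `λ = 0`, the bound `D ≤ m / B` already gives `L ≤ α / B → 0`
(`JSQ.lossProb_le_load`).
-/

namespace JSQ

/-! ### Semigroups of finite continuous-time Markov chains -/

section FiniteMarkovSemigroup

open Matrix

variable {ι : Type*} [Fintype ι] [DecidableEq ι]

open scoped Matrix.Norms.Operator in
/-- The exponential series of a real matrix converges entrywise. -/
theorem hasSum_exp_apply (A : Matrix ι ι ℝ) (x y : ι) :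
    HasSum (fun n : ℕ => ((n.factorial : ℝ))⁻¹ * (A ^ n) x y) (NormedSpace.exp A x y) := by
  have h := NormedSpace.exp_series_hasSum_exp' (𝕂 := ℝ) A
  have h2 : Continuous fun M : Matrix ι ι ℝ => M x y :=
    (continuous_apply y).comp (continuous_apply x)
  exact h.map (⟨⟨fun M : Matrix ι ι ℝ => M x y, rfl⟩, fun _ _ => rfl⟩ : Matrix ι ι ℝ →+ ℝ) h2

open scoped Matrix.Norms.Operator in
theorem hasDerivAt_exp_smul_apply (A : Matrix ι ι ℝ) (t : ℝ) (x y : ι) :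
    HasDerivAt (fun s : ℝ => NormedSpace.exp (s • A) x y)
      ((NormedSpace.exp (t • A) * A) x y) t := by
  have h := hasDerivAt_exp_smul_const (𝕂 := ℝ) A t
  exact hasDerivAt_pi.1 (hasDerivAt_pi.1 h x) y

theorem exp_add_smul (A : Matrix ι ι ℝ) (s t : ℝ) :
    NormedSpace.exp ((s + t) • A) = NormedSpace.exp (s • A) * NormedSpace.exp (t • A) := by
  rw [add_smul]
  exact Matrix.exp_add_of_commute _ _ (((Commute.refl A).smul_left s).smul_right t)

theorem pow_apply_nonneg {A : Matrix ι ι ℝ} (hA : ∀ x y, 0 ≤ A x y) (n : ℕ) (x y : ι) :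
    0 ≤ (A ^ n) x y := by
  induction n generalizing x with
  | zero => rw [pow_zero, Matrix.one_apply]; split_ifs <;> norm_num
  | succ n ih =>
    rw [pow_succ', Matrix.mul_apply]
    exact Finset.sum_nonneg fun z _ => mul_nonneg (hA x z) (ih z)

theorem exp_apply_nonneg {A : Matrix ι ι ℝ} (hA : ∀ x y, 0 ≤ A x y) (x y : ι) :
    0 ≤ NormedSpace.exp A x y :=
  (hasSum_exp_apply A x y).nonneg fun n => mul_nonneg (by positivity) (pow_apply_nonneg hA n x y)

/-- If all entries of `A` are nonnegative and some power of `A` has a positive entry at `(x, y)`,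
so has the exponential of `A`. -/
theorem exp_apply_pos {A : Matrix ι ι ℝ} (hA : ∀ x y, 0 ≤ A x y) {x y : ι} {n : ℕ}
    (hn : 0 < (A ^ n) x y) : 0 < NormedSpace.exp A x y :=
  (by positivity : 0 < ((n.factorial : ℝ))⁻¹ * (A ^ n) x y).trans_le
    (le_hasSum (hasSum_exp_apply A x y) n fun m _ =>
      mul_nonneg (by positivity) (pow_apply_nonneg hA m x y))

/-- A rate matrix: nonnegative off-diagonal entries and zero row sums. -/
structure IsRateMatrix (Q : Matrix ι ι ℝ) : Prop where
  nonneg : ∀ x y, x ≠ y → 0 ≤ Q x y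
  row_sum : ∀ x, ∑ y, Q x y = 0

/-- A uniformization constant for `Q`: after adding this multiple of the identity, all diagonal
entries are at least one. -/
def uniformizationRate (Q : Matrix ι ι ℝ) : ℝ := 1 + ∑ x, |Q x x|

theorem one_le_uniformized_diag (Q : Matrix ι ι ℝ) (x : ι) :
    1 ≤ (Q + uniformizationRate Q • (1 : Matrix ι ι ℝ)) x x := by
  have h : |Q x x| ≤ ∑ x, |Q x x| :=
    Finset.single_le_sum (f := fun x => |Q x x|) (fun _ _ => abs_nonneg _) (Finset.mem_univ x)
  have h2 := neg_abs_le (Q x x)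
  simp only [Matrix.add_apply, Matrix.smul_apply, Matrix.one_apply_eq, smul_eq_mul,
    uniformizationRate]
  linarith

variable {Q : Matrix ι ι ℝ}

theorem uniformized_of_ne (Q : Matrix ι ι ℝ) {x y : ι} (h : x ≠ y) :
    (Q + uniformizationRate Q • (1 : Matrix ι ι ℝ)) x y = Q x y := by
  simp [Matrix.one_apply_ne h]

theorem IsRateMatrix.uniformized_nonneg (hQ : IsRateMatrix Q) (x y : ι) :
    0 ≤ (Q + uniformizationRate Q • (1 : Matrix ι ι ℝ)) x y := by
  by_cases h : x = y
  · subst h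
    exact zero_le_one.trans (one_le_uniformized_diag Q x)
  · rw [uniformized_of_ne Q h]
    exact hQ.nonneg x y h

/-- Uniformization: the semigroup of `Q` is a positive multiple of the exponential of a matrix
which is nonnegative when `Q` is a rate matrix. -/
theorem exp_smul_eq_uniformized (Q : Matrix ι ι ℝ) (t : ℝ) :
    NormedSpace.exp (t • Q) = Real.exp (-(t * uniformizationRate Q)) •
      NormedSpace.exp (t • (Q + uniformizationRate Q • (1 : Matrix ι ι ℝ))) := by
  set c := uniformizationRate Q
  have h1 : t • Q = Matrix.diagonal (fun _ => -(t * c)) + t • (Q + c • (1 : Matrix ι ι ℝ)) := by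
    ext x y
    by_cases h : x = y
    · subst h; simp
    · simp [h]
  have h2 : Matrix.diagonal (fun _ : ι => -(t * c)) = (-(t * c)) • (1 : Matrix ι ι ℝ) := by
    rw [Matrix.smul_one_eq_diagonal]
  rw [h1, Matrix.exp_add_of_commute, Matrix.exp_diagonal]
  · ext x y
    rw [Matrix.diagonal_mul, Pi.coe_exp, ← Real.exp_eq_exp_ℝ]
    rfl
  · rw [h2]
    exact (Commute.one_left _).smul_left _

theorem IsRateMatrix.exp_smul_nonneg (hQ : IsRateMatrix Q) {t : ℝ} (ht : 0 ≤ t) (x y : ι) :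
    0 ≤ NormedSpace.exp (t • Q) x y := by
  rw [exp_smul_eq_uniformized]
  exact mul_nonneg (Real.exp_pos _).le
    (exp_apply_nonneg (fun x y => mul_nonneg ht (hQ.uniformized_nonneg x y)) x y)

theorem IsRateMatrix.exp_smul_row_sum (hQ : IsRateMatrix Q) (t : ℝ) (x : ι) :
    ∑ y, NormedSpace.exp (t • Q) x y = 1 := by
  have hs : HasSum (fun n : ℕ => ∑ y, ((n.factorial : ℝ))⁻¹ * ((t • Q) ^ n) x y)
      (∑ y, NormedSpace.exp (t • Q) x y) :=
    hasSum_sum fun y _ => hasSum_exp_apply _ x y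
  have h0 : (t • Q) *ᵥ (fun _ => 1) = 0 := by
    ext z
    simp [Matrix.mulVec, dotProduct, ← Finset.mul_sum, hQ.row_sum]
  have h1 : ∀ n : ℕ, n ≠ 0 → ∑ y, ((n.factorial : ℝ))⁻¹ * ((t • Q) ^ n) x y = 0 := by
    intro n hn
    obtain ⟨k, rfl⟩ := Nat.exists_eq_succ_of_ne_zero hn
    have h2 : ((t • Q) ^ (k + 1)) *ᵥ (fun _ => (1 : ℝ)) = 0 := by
      rw [pow_succ, ← Matrix.mulVec_mulVec, h0, Matrix.mulVec_zero]
    have h3 := congrFun h2 x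
    simp only [Matrix.mulVec, dotProduct, mul_one, Pi.zero_apply] at h3
    rw [← Finset.mul_sum, Nat.succ_eq_add_one, h3, mul_zero]
  rw [hs.unique (hasSum_single 0 h1)]
  simp [Matrix.one_apply]

/-- Doeblin's contraction: if every row of the stochastic matrix `P` gives mass at least `ε` to
the state `o`, then `P` shrinks the oscillation of a function by the factor `1 - ε ^ 2`: two
independent copies of the chain meet at `o` after one step with probability at least `ε ^ 2`. -/
theorem osc_mulVec_le {P : Matrix ι ι ℝ} (hP : ∀ x y, 0 ≤ P x y) (hrow : ∀ x, ∑ y, P x y = 1)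
    {o : ι} {ε : ℝ} (hε : 0 ≤ ε) (hPo : ∀ x, ε ≤ P x o) {g : ι → ℝ} {δ : ℝ}
    (hg : ∀ x y, |g x - g y| ≤ δ) (x y : ι) :
    |∑ z, P x z * g z - ∑ w, P y w * g w| ≤ (1 - ε ^ 2) * δ := by
  have hδ : 0 ≤ δ := (abs_nonneg _).trans (hg o o)
  have h1 : ∑ z, P x z * g z - ∑ w, P y w * g w
      = ∑ z, ∑ w, P x z * P y w * (g z - g w) := by
    have e1 : ∑ z, P x z * g z = ∑ z, ∑ w, P x z * P y w * g z := by
      refine Finset.sum_congr rfl fun z _ => ?_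
      rw [← Finset.sum_mul, ← Finset.mul_sum, hrow, mul_one]
    have e2 : ∑ w, P y w * g w = ∑ z, ∑ w, P x z * P y w * g w := by
      rw [Finset.sum_comm]
      refine Finset.sum_congr rfl fun w _ => ?_
      rw [← Finset.sum_mul, ← Finset.sum_mul, hrow, one_mul]
    rw [e1, e2, ← Finset.sum_sub_distrib]
    refine Finset.sum_congr rfl fun z _ => ?_
    rw [← Finset.sum_sub_distrib]
    exact Finset.sum_congr rfl fun w _ => by ring
  -- The pair `(o, o)` contributes nothing, which frees mass at least `ε ^ 2`.
  have h2 : ∀ z w, |P x z * P y w * (g z - g w)|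
      ≤ P x z * P y w * δ - (if z = o then if w = o then ε ^ 2 * δ else 0 else 0) := by
    intro z w
    have hpos : 0 ≤ P x z * P y w := mul_nonneg (hP x z) (hP y w)
    rw [abs_mul, abs_of_nonneg hpos]
    split_ifs with hz hw
    · rw [hz, hw]
      have : ε ^ 2 ≤ P x o * P y o := by
        rw [sq]; exact mul_le_mul (hPo x) (hPo y) hε (hP x o)
      rw [sub_self, abs_zero, mul_zero, ← sub_mul]
      exact mul_nonneg (sub_nonneg.2 this) hδ
    all_goals
      rw [sub_zero]
      exact mul_le_mul_of_nonneg_left (hg z w) hpos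
  calc |∑ z, P x z * g z - ∑ w, P y w * g w|
      ≤ ∑ z, ∑ w, |P x z * P y w * (g z - g w)| := by
        rw [h1]
        exact (Finset.abs_sum_le_sum_abs _ _).trans
          (Finset.sum_le_sum fun z _ => Finset.abs_sum_le_sum_abs _ _)
    _ ≤ ∑ z, ∑ w, (P x z * P y w * δ
          - (if z = o then if w = o then ε ^ 2 * δ else 0 else 0)) :=
        Finset.sum_le_sum fun z _ => Finset.sum_le_sum fun w _ => h2 z w
    _ = (1 - ε ^ 2) * δ := by
        simp only [Finset.sum_sub_distrib, ← Finset.sum_mul, ← Finset.mul_sum, hrow, mul_one]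
        have : ∑ z, ∑ w, (if z = o then if w = o then ε ^ 2 * δ else 0 else 0) = ε ^ 2 * δ := by
          rw [Finset.sum_eq_single o (by intro z _ hz; simp [hz]) (by simp)]
          simp
        rw [this]
        ring

theorem osc_pow_le {P : Matrix ι ι ℝ} (hP : ∀ x y, 0 ≤ P x y) (hrow : ∀ x, ∑ y, P x y = 1)
    {o : ι} {ε : ℝ} (hε : 0 ≤ ε) (hPo : ∀ x, ε ≤ P x o) (n : ℕ) (y x x' : ι) :
    |(P ^ n) x y - (P ^ n) x' y| ≤ (1 - ε ^ 2) ^ n := by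
  induction n generalizing x x' with
  | zero =>
    simp only [pow_zero, Matrix.one_apply]
    split_ifs <;> norm_num
  | succ n ih =>
    rw [pow_succ' P, pow_succ' (1 - ε ^ 2), Matrix.mul_apply, Matrix.mul_apply]
    exact osc_mulVec_le hP hrow hε hPo ih x x'

/-- A finite-state continuous-time Markov chain with a state `o` that is reached from everywhere
within one unit of time with positive probability converges to a limit law which does not depend
on the initial state. -/
theorem IsRateMatrix.exists_tendsto_exp_smul (hQ : IsRateMatrix Q) (o : ι)
    (ho : ∀ x, 0 < NormedSpace.exp Q x o) :
    ∃ π : ι → ℝ, ∀ x y,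
      Tendsto (fun t : ℝ => NormedSpace.exp (t • Q) x y) atTop (𝓝 (π y)) := by
  set P := NormedSpace.exp Q with hPdef
  have hP1 : P = NormedSpace.exp ((1 : ℝ) • Q) := by rw [one_smul]
  have hP : ∀ x y, 0 ≤ P x y := by
    rw [hP1]; exact hQ.exp_smul_nonneg zero_le_one
  have hrow : ∀ x, ∑ y, P x y = 1 := by
    rw [hP1]; exact hQ.exp_smul_row_sum 1
  obtain ⟨ε, hε, hPo⟩ : ∃ ε : ℝ, 0 < ε ∧ ∀ x, ε ≤ P x o := by
    obtain ⟨x₀, -, hx₀⟩ := Finset.exists_min_image Finset.univ (fun x => P x o) ⟨o, Finset.mem_univ o⟩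
    exact ⟨P x₀ o, ho x₀, fun x => hx₀ x (Finset.mem_univ x)⟩
  have hε1 : ε ≤ 1 := by
    refine (hPo o).trans ?_
    rw [← hrow o]
    exact Finset.single_le_sum (f := fun y => P o y) (fun y _ => hP o y) (Finset.mem_univ o)
  have hpow : ∀ n : ℕ, NormedSpace.exp ((n : ℝ) • Q) = P ^ n := by
    intro n
    rw [Nat.cast_smul_eq_nsmul, Matrix.exp_nsmul]
  have key : ∀ (n : ℕ) (t : ℝ), (n : ℝ) ≤ t → ∀ x x' y,
      |NormedSpace.exp (t • Q) x y - (P ^ n) x' y| ≤ (1 - ε ^ 2) ^ n := by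
    intro n t ht x x' y
    have e1 : NormedSpace.exp (t • Q) = NormedSpace.exp ((t - n) • Q) * P ^ n := by
      rw [← hpow, ← exp_add_smul, sub_add_cancel]
    have hr := hQ.exp_smul_row_sum (t - n) x
    have e2 : NormedSpace.exp (t • Q) x y - (P ^ n) x' y
        = ∑ z, NormedSpace.exp ((t - n) • Q) x z * ((P ^ n) z y - (P ^ n) x' y) := by
      simp only [mul_sub, Finset.sum_sub_distrib, ← Finset.sum_mul, hr, one_mul]
      rw [e1, Matrix.mul_apply]
    rw [e2]
    calc _ ≤ ∑ z, NormedSpace.exp ((t - n) • Q) x z * (1 - ε ^ 2) ^ n := by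
          refine (Finset.abs_sum_le_sum_abs _ _).trans (Finset.sum_le_sum fun z _ => ?_)
          have h0 := hQ.exp_smul_nonneg (sub_nonneg.2 ht) x z
          rw [abs_mul, abs_of_nonneg h0]
          exact mul_le_mul_of_nonneg_left (osc_pow_le hP hrow hε.le hPo n y z x') h0
      _ = (1 - ε ^ 2) ^ n := by rw [← Finset.sum_mul, hr, one_mul]
  have hgeo : Tendsto (fun n : ℕ => (1 - ε ^ 2) ^ n) atTop (𝓝 0) :=
    tendsto_pow_atTop_nhds_zero_of_lt_one (by nlinarith) (by nlinarith)
  have hcau : ∀ y, CauchySeq (fun t : ℝ => NormedSpace.exp (t • Q) o y) := by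
    intro y
    rw [Metric.cauchySeq_iff']
    intro η hη
    obtain ⟨n, hn⟩ := (hgeo.eventually (gt_mem_nhds hη)).exists
    refine ⟨n, fun t ht => ?_⟩
    rw [Real.dist_eq, hpow]
    exact (key n t ht o o y).trans_lt hn
  choose π hπ using fun y => cauchySeq_tendsto_of_complete (hcau y)
  refine ⟨π, fun x y => ?_⟩
  refine Metric.tendsto_atTop.2 fun η hη => ?_
  obtain ⟨n, hn⟩ := (hgeo.eventually (gt_mem_nhds (half_pos hη))).exists
  have h2 : |π y - (P ^ n) o y| ≤ (1 - ε ^ 2) ^ n :=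
    le_of_tendsto ((hπ y).sub_const _).abs
      ((eventually_ge_atTop (n : ℝ)).mono fun t ht => key n t ht o o y)
  refine ⟨n, fun t ht => ?_⟩
  have h1 := key n t ht x o y
  rw [Real.dist_eq]
  rw [abs_le] at h1 h2
  rw [abs_lt]
  constructor <;> linarith [h1.1, h1.2, h2.1, h2.2]

section Limit

variable {π : ι → ℝ}

theorem IsRateMatrix.limit_nonneg (hQ : IsRateMatrix Q)
    (hπ : ∀ x y, Tendsto (fun t : ℝ => NormedSpace.exp (t • Q) x y) atTop (𝓝 (π y)))
    (y : ι) : 0 ≤ π y :=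
  ge_of_tendsto (hπ y y) ((eventually_ge_atTop 0).mono fun _ ht => hQ.exp_smul_nonneg ht y y)

theorem IsRateMatrix.limit_sum_eq_one (hQ : IsRateMatrix Q) [Nonempty ι]
    (hπ : ∀ x y, Tendsto (fun t : ℝ => NormedSpace.exp (t • Q) x y) atTop (𝓝 (π y))) :
    ∑ y, π y = 1 := by
  have x : ι := Classical.arbitrary ι
  have h := tendsto_finsetSum (Finset.univ : Finset ι) fun y _ => hπ x y
  simp only [hQ.exp_smul_row_sum] at h
  exact tendsto_nhds_unique h tendsto_const_nhds

/-- The limit law is invariant under the semigroup, hence the mean drift `Q f` of any function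
vanishes under it. -/
theorem limit_sum_drift_eq_zero [Nonempty ι]
    (hπ : ∀ x y, Tendsto (fun t : ℝ => NormedSpace.exp (t • Q) x y) atTop (𝓝 (π y)))
    (f : ι → ℝ) : ∑ x, π x * ∑ y, Q x y * f y = 0 := by
  have x₀ : ι := Classical.arbitrary ι
  have hinv : ∀ (s : ℝ) y, ∑ x, π x * NormedSpace.exp (s • Q) x y = π y := by
    intro s y
    have h1 : Tendsto (fun t : ℝ => NormedSpace.exp ((t + s) • Q) x₀ y) atTop (𝓝 (π y)) :=
      (hπ x₀ y).comp (tendsto_atTop_add_const_right _ s tendsto_id)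
    simp only [exp_add_smul, Matrix.mul_apply] at h1
    exact tendsto_nhds_unique
      (tendsto_finsetSum _ fun x _ => (hπ x₀ x).mul_const _) h1
  have hstat : ∀ y, ∑ x, π x * Q x y = 0 := by
    intro y
    have h1 : HasDerivAt (fun s : ℝ => ∑ x, π x * NormedSpace.exp (s • Q) x y)
        (∑ x, π x * (NormedSpace.exp ((0 : ℝ) • Q) * Q) x y) 0 :=
      HasDerivAt.fun_sum fun x _ => (hasDerivAt_exp_smul_apply Q 0 x y).const_mul (π x)
    simp only [hinv, zero_smul, NormedSpace.exp_zero, one_mul] at h1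
    exact h1.unique (hasDerivAt_const _ _)
  calc ∑ x, π x * ∑ y, Q x y * f y = ∑ y, (∑ x, π x * Q x y) * f y := by
        simp only [Finset.mul_sum, Finset.sum_mul]
        rw [Finset.sum_comm]
        exact Finset.sum_congr rfl fun y _ => Finset.sum_congr rfl fun x _ => by ring
    _ = 0 := by simp [hstat]

end Limit

end FiniteMarkovSemigroup

/-! ### Sampling pools and the probability of a discard -/

section Sampling

variable {N B d : ℕ}

theorem sampleProb_nonneg (mode : SamplingMode) (s : Fin d → Fin N) :
    0 ≤ sampleProb mode N d s := by
  cases mode <;> simp only [sampleProb]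
  · positivity
  · split_ifs <;> positivity

open Classical in
theorem card_injective_into (F : Finset (Fin N)) :
    (Finset.univ.filter fun s : Fin d → Fin N => (∀ k, s k ∈ F) ∧ Function.Injective s).card
      = F.card.descFactorial d := by
  have h : Fintype.card (Fin d ↪ F) = F.card.descFactorial d := by
    rw [Fintype.card_embedding_eq, Fintype.card_coe, Fintype.card_fin]
  rw [← h, ← Finset.card_univ]
  symm
  refine Finset.card_bij (fun e _ k => (e k : Fin N)) ?_ ?_ ?_
  · intro e _
    rw [Finset.mem_filter]
    exact ⟨Finset.mem_univ _, fun k => (e k).2, fun k l hkl => e.injective (Subtype.ext hkl)⟩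
  · intro e _ e' _ hee
    ext k
    exact congrArg Fin.val (congrFun hee k)
  · intro s hs
    rw [Finset.mem_filter] at hs
    exact ⟨⟨fun k => ⟨s k, hs.2.1 k⟩, fun k l hkl => hs.2.2 (congrArg Subtype.val hkl)⟩,
      Finset.mem_univ _, rfl⟩

open Classical in
theorem sum_sampleProb_withReplacement (F : Finset (Fin N)) :
    ∑ s : Fin d → Fin N with ∀ k, s k ∈ F, sampleProb .withReplacement N d s
      = (F.card : ℝ) ^ d / (N : ℝ) ^ d := by
  have h : (Finset.univ.filter fun s : Fin d → Fin N => ∀ k, s k ∈ F)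
      = Fintype.piFinset fun _ => F := by
    ext s; simp
  simp only [sampleProb, Finset.sum_const, h, Fintype.card_piFinset_const, nsmul_eq_mul]
  push_cast
  ring

open Classical in
theorem sum_sampleProb_withoutReplacement (F : Finset (Fin N)) :
    ∑ s : Fin d → Fin N with ∀ k, s k ∈ F, sampleProb .withoutReplacement N d s
      = (F.card.descFactorial d : ℝ) / (N.descFactorial d : ℝ) := by
  simp only [sampleProb]
  rw [← Finset.sum_filter, Finset.filter_filter, Finset.sum_const, card_injective_into,
    nsmul_eq_mul]
  ring

theorem descFactorial_mul_pow_le {F N : ℕ} (h : F ≤ N) (d : ℕ) :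
    F.descFactorial d * N ^ d ≤ F ^ d * N.descFactorial d := by
  induction d with
  | zero => simp
  | succ d ih =>
    have h1 : (F - d) * N ≤ F * (N - d) := by
      rw [Nat.sub_mul, Nat.mul_sub, mul_comm d N]
      have : F * d ≤ N * d := Nat.mul_le_mul_right d h
      omega
    calc F.descFactorial (d + 1) * N ^ (d + 1)
        = ((F - d) * N) * (F.descFactorial d * N ^ d) := by
          rw [Nat.descFactorial_succ]; ring
      _ ≤ (F * (N - d)) * (F ^ d * N.descFactorial d) := Nat.mul_le_mul h1 ih
      _ = F ^ (d + 1) * N.descFactorial (d + 1) := by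
          rw [Nat.descFactorial_succ]; ring

open Classical in
/-- The probability that all `d` sampled pools lie in `F` is at most `(|F| / N) ^ d`, whichever way
the pools are sampled. -/
theorem sum_sampleProb_le (mode : SamplingMode) (hN : 1 ≤ N) (hd : d ≤ N) (F : Finset (Fin N)) :
    ∑ s : Fin d → Fin N with ∀ k, s k ∈ F, sampleProb mode N d s
      ≤ ((F.card : ℝ) / N) ^ d := by
  cases mode
  · rw [sum_sampleProb_withReplacement, div_pow]
  · rw [sum_sampleProb_withoutReplacement, div_pow]
    have hF : F.card ≤ N := (Finset.card_le_univ F).trans_eq (Fintype.card_fin N)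
    have h1 : (0 : ℝ) < N.descFactorial d := by exact_mod_cast Nat.descFactorial_pos.2 hd
    have h2 : (0 : ℝ) < (N : ℝ) ^ d := by positivity
    rw [div_le_div_iff₀ h1 h2]
    exact_mod_cast descFactorial_mul_pow_le hF d

theorem sum_sampleProb (mode : SamplingMode) (hN : 1 ≤ N) (hd : d ≤ N) :
    ∑ s : Fin d → Fin N, sampleProb mode N d s = 1 := by
  classical
  have h : (Finset.univ : Finset (Fin d → Fin N))
      = Finset.univ.filter fun s => ∀ k, s k ∈ (Finset.univ : Finset (Fin N)) := by
    simp
  rw [h]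
  cases mode
  · rw [sum_sampleProb_withReplacement, Finset.card_univ, Fintype.card_fin]
    exact div_self (by positivity)
  · rw [sum_sampleProb_withoutReplacement, Finset.card_univ, Fintype.card_fin]
    have h1 : (0 : ℝ) < N.descFactorial d := by exact_mod_cast Nat.descFactorial_pos.2 hd
    exact div_self h1.ne'

variable {tie : State N B → (Fin d → Fin N) → Fin N → ℝ}

theorem assignProb_nonneg (mode : SamplingMode) (h_tie : IsTieBreakRule tie) (x : State N B)
    (i : Fin N) : 0 ≤ assignProb mode tie x i :=
  Finset.sum_nonneg fun s _ => mul_nonneg (sampleProb_nonneg mode s) (h_tie.nonneg x s i)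

theorem sum_assignProb (mode : SamplingMode) (h_tie : IsTieBreakRule tie) (hN : 1 ≤ N)
    (hd : d ≤ N) (x : State N B) : ∑ i, assignProb mode tie x i = 1 := by
  simp only [assignProb]
  rw [Finset.sum_comm]
  simp only [← Finset.mul_sum, h_tie.sum_eq_one, mul_one]
  exact sum_sampleProb mode hN hd

theorem discardProb_nonneg (mode : SamplingMode) (h_tie : IsTieBreakRule tie) (x : State N B) :
    0 ≤ discardProb mode tie x :=
  Finset.sum_nonneg fun i _ => assignProb_nonneg mode h_tie x i

/-- The total number of active tasks. -/
def totalTasks (x : State N B) : ℝ := ∑ i, ((x i : ℕ) : ℝ)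

theorem totalTasks_nonneg (x : State N B) : 0 ≤ totalTasks x :=
  Finset.sum_nonneg fun _ _ => Nat.cast_nonneg _

theorem totalTasks_le (x : State N B) : totalTasks x ≤ N * B := by
  calc totalTasks x ≤ ∑ _i : Fin N, (B : ℝ) :=
        Finset.sum_le_sum fun i _ => by exact_mod_cast Nat.lt_succ_iff.1 (x i).2
    _ = N * B := by simp

theorem card_full_mul_le_totalTasks (x : State N B) :
    ((Finset.univ.filter fun i => (x i : ℕ) = B).card : ℝ) * B ≤ totalTasks x := by
  calc ((Finset.univ.filter fun i => (x i : ℕ) = B).card : ℝ) * B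
      = ∑ i with (x i : ℕ) = B, ((x i : ℕ) : ℝ) := by
        rw [Finset.sum_congr rfl fun i hi => by rw [(Finset.mem_filter.1 hi).2]]
        simp
    _ ≤ totalTasks x :=
        Finset.sum_le_sum_of_subset_of_nonneg (Finset.filter_subset _ _)
          fun _ _ _ => Nat.cast_nonneg _

/-- The minimum of the sample is full only if the whole sample is, so a task is discarded with
probability at most the `d`-th power of the fraction of full pools. -/
theorem discardProb_le_card_full (mode : SamplingMode) (h_tie : IsTieBreakRule tie) (hN : 1 ≤ N)
    (hd : d ≤ N) (x : State N B) :
    discardProb mode tie x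
      ≤ (((Finset.univ.filter fun i => (x i : ℕ) = B).card : ℝ) / N) ^ d := by
  classical
  refine le_trans ?_ (sum_sampleProb_le mode hN hd (Finset.univ.filter fun i => (x i : ℕ) = B))
  simp only [discardProb, assignProb]
  rw [Finset.sum_comm, Finset.sum_filter]
  refine Finset.sum_le_sum fun s _ => ?_
  rw [← Finset.mul_sum]
  split_ifs with h
  · refine mul_le_of_le_one_right (sampleProb_nonneg mode s) ?_
    rw [← h_tie.sum_eq_one x s]
    exact Finset.sum_le_sum_of_subset_of_nonneg (Finset.filter_subset _ _)
      fun i _ _ => h_tie.nonneg x s i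
  · refine le_of_eq (mul_eq_zero_of_right _ (Finset.sum_eq_zero fun i hi => ?_))
    by_contra hne
    refine h fun k => Finset.mem_filter.2 ⟨Finset.mem_univ _, ?_⟩
    have h1 : (x i : ℕ) ≤ (x (s k) : ℕ) := h_tie.minimal x s i hne k
    have h2 := (x (s k)).2
    have h3 := (Finset.mem_filter.1 hi).2
    omega

theorem discardProb_le_load_pow (mode : SamplingMode) (h_tie : IsTieBreakRule tie) (hB : 1 ≤ B)
    (hN : 1 ≤ N) (hd : d ≤ N) (x : State N B) :
    discardProb mode tie x ≤ (totalTasks x / (N * B)) ^ d := by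
  have hB' : (0 : ℝ) < B := by exact_mod_cast hB
  have hN' : (0 : ℝ) < N := by exact_mod_cast hN
  refine (discardProb_le_card_full mode h_tie hN hd x).trans (pow_le_pow_left₀ (by positivity) ?_ d)
  rw [div_le_div_iff₀ hN' (by positivity)]
  nlinarith [card_full_mul_le_totalTasks x]

theorem mul_pow_mul_one_sub_le_one {u : ℝ} (h0 : 0 ≤ u) (h1 : u ≤ 1) (d : ℕ) :
    d * (u ^ d * (1 - u)) ≤ 1 := by
  have h2 : (d : ℝ) * u ^ d ≤ ∑ k ∈ Finset.range d, u ^ k := by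
    calc (d : ℝ) * u ^ d = ∑ _k ∈ Finset.range d, u ^ d := by simp
      _ ≤ ∑ k ∈ Finset.range d, u ^ k :=
        Finset.sum_le_sum fun k hk =>
          pow_le_pow_of_le_one h0 h1 (Finset.mem_range.1 hk).le
  calc (d : ℝ) * (u ^ d * (1 - u)) = (d * u ^ d) * (1 - u) := by ring
    _ ≤ (∑ k ∈ Finset.range d, u ^ k) * (1 - u) :=
      mul_le_mul_of_nonneg_right h2 (sub_nonneg.2 h1)
    _ = 1 - u ^ d := geom_sum_mul_neg u d
    _ ≤ 1 := by linarith [pow_nonneg h0 d]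

/-- Discards require a nearly full system: the product of the discard probability and the free
capacity per pool is of order `1 / d`, uniformly over all states. -/
theorem discardProb_mul_free_le (mode : SamplingMode) (h_tie : IsTieBreakRule tie) (hB : 1 ≤ B)
    (hN : 1 ≤ N) (hd1 : 1 ≤ d) (hd : d ≤ N) (x : State N B) :
    discardProb mode tie x * (N * B - totalTasks x) ≤ N * (B / d) := by
  have hB' : (0 : ℝ) < B := by exact_mod_cast hB
  have hN' : (0 : ℝ) < N := by exact_mod_cast hN
  have hd' : (0 : ℝ) < d := by exact_mod_cast hd1
  have hNB : (0 : ℝ) < N * B := by positivity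
  set u := totalTasks x / (N * B) with hu
  have hu0 : 0 ≤ u := div_nonneg (totalTasks_nonneg x) hNB.le
  have hu1 : u ≤ 1 := (div_le_one hNB).2 (totalTasks_le x)
  have hS : totalTasks x = N * B * u := by rw [hu]; field_simp
  have h1 := mul_pow_mul_one_sub_le_one hu0 hu1 d
  have h2 : u ^ d * (1 - u) ≤ 1 / d := by
    rw [le_div_iff₀ hd']; linarith
  calc discardProb mode tie x * (N * B - totalTasks x)
      ≤ u ^ d * (N * B - totalTasks x) :=
        mul_le_mul_of_nonneg_right (discardProb_le_load_pow mode h_tie hB hN hd x)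
          (sub_nonneg.2 (totalTasks_le x))
    _ = N * B * (u ^ d * (1 - u)) := by rw [hS]; ring
    _ ≤ N * B * (1 / d) := mul_le_mul_of_nonneg_left h2 hNB.le
    _ = N * (B / d) := by ring

end Sampling

/-! ### The generator and the total number of tasks -/

section Generator

variable {N B d : ℕ}

theorem IsOneMore.eq_right {i : Fin N} {x y y' : State N B} (h : IsOneMore i x y)
    (h' : IsOneMore i x y') : y = y' :=
  funext fun j => Fin.ext ((h j).trans (h' j).symm)

theorem IsOneMore.eq_left {i : Fin N} {x x' y : State N B} (h : IsOneMore i x y)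
    (h' : IsOneMore i x' y) : x = x' :=
  funext fun j => Fin.ext (Nat.add_right_cancel ((h j).symm.trans (h' j)))

theorem not_isOneMore_self (i : Fin N) (x : State N B) : ¬ IsOneMore i x x := fun h => by
  simpa using h i

theorem exists_isOneMore_right (i : Fin N) (x : State N B) :
    (∃ y, IsOneMore i x y) ↔ (x i : ℕ) ≠ B := by
  constructor
  · rintro ⟨y, hy⟩ h
    have h1 := hy i
    have h2 := (y i).2
    simp only [if_true] at h1
    omega
  · intro h
    refine ⟨Function.update x i ⟨x i + 1, by have := (x i).2; omega⟩, fun j => ?_⟩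
    by_cases hj : j = i
    · subst hj; simp
    · simp [hj]

theorem exists_isOneMore_left (i : Fin N) (x : State N B) :
    (∃ y, IsOneMore i y x) ↔ (x i : ℕ) ≠ 0 := by
  constructor
  · rintro ⟨y, hy⟩ h
    have h1 := hy i
    simp only [if_true] at h1
    omega
  · intro h
    refine ⟨Function.update x i ⟨x i - 1, by have := (x i).2; omega⟩, fun j => ?_⟩
    by_cases hj : j = i
    · subst hj; simp; omega
    · simp [hj]

theorem IsOneMore.totalTasks_eq {i : Fin N} {x y : State N B} (h : IsOneMore i x y) :
    totalTasks y = totalTasks x + 1 := by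
  have h1 : ∀ j, ((y j : ℕ) : ℝ) = ((x j : ℕ) : ℝ) + if j = i then 1 else 0 := fun j => by
    rw [h j]; push_cast; rfl
  simp only [totalTasks, h1, Finset.sum_add_distrib, Finset.sum_ite_eq', Finset.mem_univ, if_true]

open Classical in
theorem sum_isOneMore_right (i : Fin N) (x : State N B) (c : ℝ) :
    ∑ y, (if IsOneMore i x y then c else 0) = if (x i : ℕ) = B then 0 else c := by
  split_ifs with h
  · refine Finset.sum_eq_zero fun y _ => if_neg fun hy => ?_
    exact (exists_isOneMore_right i x).1 ⟨y, hy⟩ h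
  · obtain ⟨y, hy⟩ := (exists_isOneMore_right i x).2 h
    rw [Finset.sum_eq_single y (fun z _ hz => if_neg fun h' => hz (h'.eq_right hy)) (by simp),
      if_pos hy]

open Classical in
theorem sum_isOneMore_left (i : Fin N) (x : State N B) (c : ℝ) :
    ∑ y, (if IsOneMore i y x then ((x i : ℕ) : ℝ) * c else 0) = ((x i : ℕ) : ℝ) * c := by
  by_cases h : (x i : ℕ) = 0
  · simp [h]
  · obtain ⟨y, hy⟩ := (exists_isOneMore_left i x).2 h
    rw [Finset.sum_eq_single y (fun z _ hz => if_neg fun h' => hz (h'.eq_left hy)) (by simp),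
      if_pos hy]

variable {tie : State N B → (Fin d → Fin N) → Fin N → ℝ} {a : ℝ}

theorem jumpRate_nonneg (mode : SamplingMode) (h_tie : IsTieBreakRule tie) (ha : 0 ≤ a)
    (x y : State N B) : 0 ≤ jumpRate mode tie a x y := by
  refine add_nonneg (Finset.sum_nonneg fun i _ => ?_) (Finset.sum_nonneg fun i _ => ?_)
  · split_ifs
    exacts [mul_nonneg ha (assignProb_nonneg mode h_tie x i), le_rfl]
  · split_ifs
    exacts [Nat.cast_nonneg _, le_rfl]

theorem isRateMatrix_generator (mode : SamplingMode) (h_tie : IsTieBreakRule tie) (ha : 0 ≤ a) :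
    IsRateMatrix (generator mode tie a) where
  nonneg x y hxy := by
    simp only [generator, Matrix.of_apply, if_neg hxy.symm]
    exact jumpRate_nonneg mode h_tie ha x y
  row_sum x := by
    rw [← Finset.add_sum_erase _ _ (Finset.mem_univ x)]
    simp only [generator, Matrix.of_apply, if_true]
    rw [Finset.sum_congr rfl fun y hy => if_neg (Finset.ne_of_mem_erase hy)]
    exact neg_add_cancel _

theorem sum_generator_mul (mode : SamplingMode) (f : State N B → ℝ) (x : State N B) :
    ∑ y, generator mode tie a x y * f y = ∑ y, jumpRate mode tie a x y * (f y - f x) := by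
  have h1 : ∑ y ∈ Finset.univ.erase x, generator mode tie a x y * f y
      = ∑ y ∈ Finset.univ.erase x, jumpRate mode tie a x y * f y :=
    Finset.sum_congr rfl fun y hy => by
      simp only [generator, Matrix.of_apply, if_neg (Finset.ne_of_mem_erase hy)]
  have h2 : generator mode tie a x x = -∑ z ∈ Finset.univ.erase x, jumpRate mode tie a x z :=
    if_pos rfl
  rw [← Finset.add_sum_erase _ _ (Finset.mem_univ x), h1, h2,
    ← Finset.add_sum_erase (a := x) _ (fun y => jumpRate mode tie a x y * (f y - f x))
      (Finset.mem_univ x)]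
  simp only [sub_self, mul_zero, zero_add, mul_sub, Finset.sum_sub_distrib, ← Finset.sum_mul]
  ring

/-- The generator acting on a function of the total number of tasks: accepted arrivals raise the
total by one, and each task leaves at rate one. -/
theorem sum_generator_mul_totalTasks (mode : SamplingMode) (h_tie : IsTieBreakRule tie)
    (hN : 1 ≤ N) (hd : d ≤ N) (φ : ℝ → ℝ) (x : State N B) :
    ∑ y, generator mode tie a x y * φ (totalTasks y)
      = a * (1 - discardProb mode tie x) * (φ (totalTasks x + 1) - φ (totalTasks x))
        + totalTasks x * (φ (totalTasks x - 1) - φ (totalTasks x)) := by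
  classical
  rw [sum_generator_mul mode (fun y => φ (totalTasks y))]
  simp only [jumpRate, add_mul, Finset.sum_add_distrib, Finset.sum_mul, ite_mul, zero_mul]
  congr 1
  · rw [Finset.sum_comm]
    have h1 : ∀ i : Fin N, ∑ y, (if IsOneMore i x y then
        a * assignProb mode tie x i * (φ (totalTasks y) - φ (totalTasks x)) else 0)
        = (if (x i : ℕ) = B then 0 else assignProb mode tie x i)
          * (a * (φ (totalTasks x + 1) - φ (totalTasks x))) := by
      intro i
      rw [ite_mul, zero_mul, ← sum_isOneMore_right]
      refine Finset.sum_congr rfl fun y _ => ?_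
      split_ifs with h
      · rw [h.totalTasks_eq]; ring
      · rfl
    have h2 : ∑ i, (if (x i : ℕ) = B then 0 else assignProb mode tie x i)
        = 1 - discardProb mode tie x := by
      rw [← sum_assignProb mode h_tie hN hd x, discardProb, Finset.sum_filter,
        ← Finset.sum_sub_distrib]
      refine Finset.sum_congr rfl fun i _ => ?_
      split_ifs <;> ring
    rw [Finset.sum_congr rfl fun i _ => h1 i, ← Finset.sum_mul, h2]
    ring
  · rw [Finset.sum_comm]
    rw [show totalTasks x * (φ (totalTasks x - 1) - φ (totalTasks x))
      = ∑ i, ((x i : ℕ) : ℝ) * (φ (totalTasks x - 1) - φ (totalTasks x)) from Finset.sum_mul _ _ _]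
    refine Finset.sum_congr rfl fun i _ => ?_
    rw [← sum_isOneMore_left]
    refine Finset.sum_congr rfl fun y _ => ?_
    split_ifs with h
    · have h3 := h.totalTasks_eq
      rw [show totalTasks y = totalTasks x - 1 by linarith]
    · rfl

open Classical in
/-- The empty system is reached from every state through departures alone. -/
theorem exp_generator_empty_pos (mode : SamplingMode) (h_tie : IsTieBreakRule tie) (ha : 0 ≤ a)
    (x : State N B) : 0 < NormedSpace.exp (generator mode tie a) x (fun _ => 0) := by
  set Q := generator mode tie a with hQdef
  have hQ : IsRateMatrix Q := isRateMatrix_generator mode h_tie ha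
  set A := Q + uniformizationRate Q • (1 : Matrix (State N B) (State N B) ℝ) with hA
  have hA0 : ∀ x y, 0 ≤ A x y := hQ.uniformized_nonneg
  have hpow : ∀ (n : ℕ) (x : State N B), ∑ i, (x i : ℕ) = n → 0 < (A ^ n) x (fun _ => 0) := by
    intro n
    induction n with
    | zero =>
      intro x hx
      have : x = fun _ => 0 := funext fun i => Fin.ext (by
        simpa using (Finset.sum_eq_zero_iff.1 hx) i (Finset.mem_univ i))
      rw [this]; simp
    | succ n ih =>
      intro x hx
      obtain ⟨i, -, hi⟩ := Finset.exists_ne_zero_of_sum_ne_zero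
        (show ∑ i, (x i : ℕ) ≠ 0 by omega)
      obtain ⟨y, hy⟩ := (exists_isOneMore_left i x).2 hi
      have hyn : ∑ j, (y j : ℕ) = n := by
        have h1 : ∑ j, (x j : ℕ) = ∑ j, (y j : ℕ) + 1 := by
          rw [Finset.sum_congr rfl fun j _ => hy j, Finset.sum_add_distrib]
          simp
        omega
      have hxy : x ≠ y := by
        rintro rfl; exact not_isOneMore_self i x hy
      have hjump : 0 < jumpRate mode tie a x y := by
        refine add_pos_of_nonneg_of_pos (Finset.sum_nonneg fun j _ => ?_)
          (Finset.sum_pos' (fun j _ => ?_) ⟨i, Finset.mem_univ i, ?_⟩)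
        · split_ifs
          exacts [mul_nonneg ha (assignProb_nonneg mode h_tie x j), le_rfl]
        · split_ifs
          exacts [Nat.cast_nonneg _, le_rfl]
        · rw [if_pos hy]
          exact_mod_cast Nat.pos_of_ne_zero hi
      have hAxy : 0 < A x y := by
        rw [hA, uniformized_of_ne Q hxy, hQdef]
        simpa only [generator, Matrix.of_apply, if_neg hxy.symm] using hjump
      rw [pow_succ', Matrix.mul_apply]
      exact Finset.sum_pos' (fun z _ => mul_nonneg (hA0 x z) (pow_apply_nonneg hA0 n z _))
        ⟨y, Finset.mem_univ y, mul_pos hAxy (ih y hyn)⟩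
  have h1 := exp_smul_eq_uniformized Q 1
  rw [one_smul, one_smul] at h1
  rw [h1]
  exact mul_pos (Real.exp_pos _) (exp_apply_pos hA0 (hpow _ x rfl))

end Generator

/-! ### The steady-state loss probability -/

section Loss

variable {N B d : ℕ} {tie : State N B → (Fin d → Fin N) → Fin N → ℝ} {a : ℝ}

theorem exists_isSteadyState (mode : SamplingMode) (h_tie : IsTieBreakRule tie) (ha : 0 ≤ a) :
    ∃ π : State N B → ℝ, IsSteadyState mode tie a π :=
  (isRateMatrix_generator mode h_tie ha).exists_tendsto_exp_smul (fun _ => 0) fun x => by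
    convert exp_generator_empty_pos mode h_tie ha x

theorem existsUnique_lossProb (mode : SamplingMode) (h_tie : IsTieBreakRule tie) (ha : 0 ≤ a) :
    ∃! L : ℝ, IsSteadyStateLossProb mode tie a L := by
  obtain ⟨π, hπ⟩ := exists_isSteadyState mode h_tie ha
  refine ⟨_, ⟨π, hπ, rfl⟩, ?_⟩
  rintro L ⟨π', hπ', rfl⟩
  have : π' = π := funext fun y => tendsto_nhds_unique (hπ' y y) (hπ y y)
  rw [this]

/-- Flow balance: the mean number of tasks equals the rate of accepted arrivals. -/
theorem mean_totalTasks_eq (mode : SamplingMode) (h_tie : IsTieBreakRule tie) (hN : 1 ≤ N)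
    (hd : d ≤ N) (ha : 0 ≤ a) {π : State N B → ℝ} (hπ : IsSteadyState mode tie a π) :
    ∑ x, π x * totalTasks x = a * (1 - ∑ x, π x * discardProb mode tie x) := by
  have h1 := (isRateMatrix_generator mode h_tie ha).limit_sum_eq_one hπ
  have h2 := limit_sum_drift_eq_zero hπ fun x => totalTasks x
  simp only [sum_generator_mul_totalTasks mode h_tie hN hd fun s => s] at h2
  have h3 : ∑ x, π x * (a * (1 - discardProb mode tie x) * (totalTasks x + 1 - totalTasks x)
      + totalTasks x * (totalTasks x - 1 - totalTasks x))
      = a * ∑ x, π x - a * ∑ x, π x * discardProb mode tie x - ∑ x, π x * totalTasks x := by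
    rw [Finset.mul_sum, Finset.mul_sum, ← Finset.sum_sub_distrib, ← Finset.sum_sub_distrib]
    exact Finset.sum_congr rfl fun x _ => by ring
  rw [h3, h1] at h2
  linarith

/-- The mean squared deviation of the number of tasks from the offered load `a`, obtained from the
vanishing mean drift of the square of the number of tasks. -/
theorem mean_sq_deviation_eq (mode : SamplingMode) (h_tie : IsTieBreakRule tie) (hN : 1 ≤ N)
    (hd : d ≤ N) {π : State N B → ℝ} (hπ : IsSteadyState mode tie a π) :
    ∑ x, π x * (totalTasks x - a) ^ 2
      = ∑ x, π x * (totalTasks x + a * (discardProb mode tie x * (a - totalTasks x))) := by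
  have h1 := limit_sum_drift_eq_zero hπ fun x => totalTasks x
  simp only [sum_generator_mul_totalTasks mode h_tie hN hd fun s => s] at h1
  have h2 := limit_sum_drift_eq_zero hπ fun x => totalTasks x ^ 2
  simp only [sum_generator_mul_totalTasks mode h_tie hN hd fun s => s ^ 2] at h2
  rw [← sub_eq_zero, ← Finset.sum_sub_distrib]
  refine Eq.trans ?_ (by rw [h1, h2]; ring : (1 / 2 + a) * (∑ x, π x *
    (a * (1 - discardProb mode tie x) * (totalTasks x + 1 - totalTasks x)
      + totalTasks x * (totalTasks x - 1 - totalTasks x)))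
    - 1 / 2 * (∑ x, π x *
    (a * (1 - discardProb mode tie x) * ((totalTasks x + 1) ^ 2 - totalTasks x ^ 2)
      + totalTasks x * ((totalTasks x - 1) ^ 2 - totalTasks x ^ 2))) = 0)
  rw [Finset.mul_sum, Finset.mul_sum, ← Finset.sum_sub_distrib]
  exact Finset.sum_congr rfl fun x _ => by ring

theorem lossProb_nonneg (mode : SamplingMode) (h_tie : IsTieBreakRule tie) (ha : 0 ≤ a)
    {L : ℝ} (hL : IsSteadyStateLossProb mode tie a L) : 0 ≤ L := by
  obtain ⟨π, hπ, rfl⟩ := hL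
  exact Finset.sum_nonneg fun x _ => mul_nonneg
    ((isRateMatrix_generator mode h_tie ha).limit_nonneg hπ x) (discardProb_nonneg mode h_tie x)

/-- The loss probability is at most the offered load per unit of capacity; this settles the case
of vanishing load. -/
theorem lossProb_le_load (mode : SamplingMode) (h_tie : IsTieBreakRule tie) (hB : 1 ≤ B)
    (hN : 1 ≤ N) (hd1 : 1 ≤ d) (hd : d ≤ N) (ha : 0 ≤ a)
    {L : ℝ} (hL : IsSteadyStateLossProb mode tie a L) : L ≤ a / N / B := by
  have hL0 := lossProb_nonneg mode h_tie ha hL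
  obtain ⟨π, hπ, rfl⟩ := hL
  have hB' : (0 : ℝ) < B := by exact_mod_cast hB
  have hN' : (0 : ℝ) < N := by exact_mod_cast hN
  have hNB : (0 : ℝ) < N * B := by positivity
  have hmean := mean_totalTasks_eq mode h_tie hN hd ha hπ
  have h1 : ∑ x, π x * discardProb mode tie x ≤ ∑ x, π x * (totalTasks x / (N * B)) := by
    refine Finset.sum_le_sum fun x _ => mul_le_mul_of_nonneg_left ?_
      ((isRateMatrix_generator mode h_tie ha).limit_nonneg hπ x)
    exact (discardProb_le_load_pow mode h_tie hB hN hd x).trans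
      (pow_le_of_le_one (div_nonneg (totalTasks_nonneg x) hNB.le)
        ((div_le_one hNB).2 (totalTasks_le x)) (by omega))
  refine h1.trans ?_
  simp only [← mul_div_assoc]
  rw [← Finset.sum_div, hmean, div_div]
  refine div_le_div_of_nonneg_right ?_ hNB.le
  nlinarith

/-- The quantitative loss bound, uniform in the tie-breaking rule and in the sampling mode. -/
theorem sq_load_mul_lossProb_le (mode : SamplingMode) (h_tie : IsTieBreakRule tie) (hB : 1 ≤ B)
    (hN : 1 ≤ N) (hd1 : 1 ≤ d) (hd : d ≤ N) (ha : 0 ≤ a)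
    {L : ℝ} (hL : IsSteadyStateLossProb mode tie a L) :
    (a / N * L) ^ 2 ≤ a / N * (B / d + max (a / N - B) 0) + B / N := by
  obtain ⟨π, hπ, hLπ⟩ := hL
  have hN' : (0 : ℝ) < N := by exact_mod_cast hN
  have hQ := isRateMatrix_generator mode h_tie ha
  have hπ0 := hQ.limit_nonneg hπ
  have hπ1 := hQ.limit_sum_eq_one hπ
  have hmean := mean_totalTasks_eq mode h_tie hN hd ha hπ
  rw [← hLπ] at hmean
  have hsq := mean_sq_deviation_eq mode h_tie hN hd hπ
  set M := max (a / N - B) 0 with hM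
  -- By flow balance the mean deviation of the number of tasks from `a` is `-a * L`.
  have h1 : (a * L) ^ 2 ≤ ∑ x, π x * (totalTasks x - a) ^ 2 := by
    have h2 : 0 ≤ ∑ x, π x * (totalTasks x - a + a * L) ^ 2 :=
      Finset.sum_nonneg fun x _ => mul_nonneg (hπ0 x) (sq_nonneg _)
    have h3 : ∑ x, π x * (totalTasks x - a + a * L) ^ 2
        = ∑ x, π x * (totalTasks x - a) ^ 2 + 2 * (a * L) * ∑ x, π x * totalTasks x
          + ((a * L) ^ 2 - 2 * a * (a * L)) * ∑ x, π x := by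
      rw [Finset.mul_sum, Finset.mul_sum, ← Finset.sum_add_distrib, ← Finset.sum_add_distrib]
      exact Finset.sum_congr rfl fun x _ => by ring
    rw [h3, hmean, hπ1] at h2
    linarith
  have hpt : ∀ x : State N B,
      totalTasks x + a * (discardProb mode tie x * (a - totalTasks x))
        ≤ N * B + a * (N * (B / d) + N * M) := by
    intro x
    have hD0 := discardProb_nonneg mode h_tie x
    have hD1 : discardProb mode tie x ≤ 1 := by
      rw [← sum_assignProb mode h_tie hN hd x]
      exact Finset.sum_le_sum_of_subset_of_nonneg (Finset.filter_subset _ _)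
        fun i _ _ => assignProb_nonneg mode h_tie x i
    have h4 := discardProb_mul_free_le mode h_tie hB hN hd1 hd x
    have h5 : a - N * B ≤ N * M := by
      calc a - N * B = N * (a / N - B) := by field_simp
        _ ≤ N * M := mul_le_mul_of_nonneg_left (le_max_left _ _) hN'.le
    have hNM : 0 ≤ N * M := mul_nonneg hN'.le (le_max_right _ _)
    have h6 : discardProb mode tie x * (a - N * B) ≤ N * M :=
      (mul_le_mul_of_nonneg_left h5 hD0).trans (mul_le_of_le_one_left hNM hD1)
    refine add_le_add (totalTasks_le x) (mul_le_mul_of_nonneg_left ?_ ha)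
    linarith
  have h7 : (a * L) ^ 2 ≤ N * B + a * (N * (B / d) + N * M) := by
    refine h1.trans (hsq.trans_le ?_)
    calc _ ≤ ∑ x, π x * (N * B + a * (N * (B / d) + N * M)) :=
          Finset.sum_le_sum fun x _ => mul_le_mul_of_nonneg_left (hpt x) (hπ0 x)
      _ = _ := by rw [← Finset.sum_mul, hπ1, one_mul]
  calc (a / N * L) ^ 2 = (a * L) ^ 2 / N ^ 2 := by field_simp
    _ ≤ (N * B + a * (N * (B / d) + N * M)) / N ^ 2 :=
      div_le_div_of_nonneg_right h7 (by positivity)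
    _ = a / N * (B / d + M) + B / N := by field_simp; ring

end Loss

end JSQ

theorem mainTheorem12 (B : ℕ) (hB : 1 ≤ B) (mode : JSQ.SamplingMode)
    (arrivalRate : ℕ → ℝ) (h_rate : ∀ N, 1 ≤ N → 0 < arrivalRate N)
    (lam : ℝ) (h_lam : lam ≤ B)
    (h_lim : Tendsto (fun N : ℕ => arrivalRate N / (N : ℝ)) atTop (𝓝 lam))
    (d : ℕ → ℕ) (hd : ∀ N, 1 ≤ N → 1 ≤ d N ∧ d N ≤ N)
    (tie : (N : ℕ) → JSQ.State N B → (Fin (d N) → Fin N) → Fin N → ℝ)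
    (h_tie : ∀ N, 1 ≤ N → JSQ.IsTieBreakRule (tie N))
    (hd_top : Tendsto d atTop atTop) :
    (∀ N, 1 ≤ N →
      ∃! L : ℝ, JSQ.IsSteadyStateLossProb mode (tie N) (arrivalRate N) L) ∧
    ∀ L : ℕ → ℝ,
      (∀ N, 1 ≤ N → JSQ.IsSteadyStateLossProb mode (tie N) (arrivalRate N) (L N)) →
      Tendsto L atTop (𝓝 0) := by
  refine ⟨fun N hN => JSQ.existsUnique_lossProb mode (h_tie N hN) (h_rate N hN).le,
    fun L hL => ?_⟩
  have hlam0 : 0 ≤ lam := ge_of_tendsto h_lim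
    ((eventually_ge_atTop 1).mono fun N hN => div_nonneg (h_rate N hN).le (Nat.cast_nonneg N))
  have hL0 : ∀ᶠ N in atTop, 0 ≤ L N := (eventually_ge_atTop 1).mono fun N hN =>
    JSQ.lossProb_nonneg mode (h_tie N hN) (h_rate N hN).le (hL N hN)
  rcases hlam0.eq_or_lt with h0 | hpos
  -- For vanishing load the bound on `(α L) ^ 2` says nothing about `L`.
  · have hbound : Tendsto (fun N : ℕ => arrivalRate N / (N : ℝ) / B) atTop (𝓝 0) := by
      simpa [← h0] using h_lim.div_const (B : ℝ)
    refine tendsto_of_tendsto_of_tendsto_of_le_of_le' tendsto_const_nhds hbound hL0 ?_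
    exact (eventually_ge_atTop 1).mono fun N hN => JSQ.lossProb_le_load mode (h_tie N hN) hB hN
      (hd N hN).1 (hd N hN).2 (h_rate N hN).le (hL N hN)
  · have hBd : Tendsto (fun N : ℕ => (B : ℝ) / (d N : ℝ)) atTop (𝓝 0) :=
      tendsto_const_nhds.div_atTop (tendsto_natCast_atTop_atTop.comp hd_top)
    have hBN : Tendsto (fun N : ℕ => (B : ℝ) / (N : ℝ)) atTop (𝓝 0) :=
      tendsto_const_nhds.div_atTop tendsto_natCast_atTop_atTop
    have hmax : Tendsto (fun N : ℕ => max (arrivalRate N / (N : ℝ) - B) 0) atTop (𝓝 0) := by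
      have h := (h_lim.sub_const (B : ℝ)).max (tendsto_const_nhds (x := (0 : ℝ)))
      rwa [max_eq_right (sub_nonpos.2 h_lam)] at h
    have hbound := (h_lim.mul (hBd.add hmax)).add hBN
    rw [add_zero, add_zero, mul_zero] at hbound
    have hsq : Tendsto (fun N : ℕ => (arrivalRate N / (N : ℝ) * L N) ^ 2) atTop (𝓝 0) := by
      refine tendsto_of_tendsto_of_tendsto_of_le_of_le' tendsto_const_nhds hbound
        (Eventually.of_forall fun N => sq_nonneg _) ?_
      exact (eventually_ge_atTop 1).mono fun N hN => JSQ.sq_load_mul_lossProb_le mode (h_tie N hN)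
        hB hN (hd N hN).1 (hd N hN).2 (h_rate N hN).le (hL N hN)
    have hprod : Tendsto (fun N : ℕ => arrivalRate N / (N : ℝ) * L N) atTop (𝓝 0) := by
      have h := hsq.sqrt
      simp only [Real.sqrt_sq_eq_abs, Real.sqrt_zero] at h
      exact (tendsto_zero_iff_abs_tendsto_zero _).2 h
    have hquot := hprod.div h_lim hpos.ne'
    rw [zero_div] at hquot
    refine hquot.congr' ((eventually_ge_atTop 1).mono fun N hN => ?_)
    have hN' : (0 : ℝ) < N := by exact_mod_cast hN
    exact mul_div_cancel_left₀ _ (div_pos (h_rate N hN) hN').ne'
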